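/- Let $\mathbb{F}=\mathbb{R}$ or $\mathbb{F}=\mathbb{C}$. An associative $\mathbb{F}$-algebra $A$ is called a locally matrix algebra if every finite subset of $A$ is contained in a subalgebra isomorphic to a matrix algebra $M_n(\mathbb{F})$ for some $n\ge 1$. For an element $a$ of a unital locally matrix algebra $A$, choose a subalgebra $A'\subset A$ containing $1_A$ and $a$ such that $A'\cong M_n(\mathbb{F})$; the normalized determinant $\overline{\det}(a)=|\det(a)|^{1/n}$, where $\det(a)$ is the determinant of the matrix corresponding to $a$ in $M_n(\mathbb{F})$, does not depend on the choices made. Theorem. Let $A$ and $B$ be unital locally matrix algebras over $\mathbb{F}$, and let $\varphi\colon A\to B$ be a surjective $\mathbb{F}$-linear map that preserves the normalized determinant, i.e. $\overline{\det}(\varphi(a))=\overline{\det}(a)$ for all $a\in A$. Then there exist invertible elements $X,Y\in B$ with $\overline{\det}(XY)=1$ such that either $\varphi(a)=X\varphi_1(a)Y$ for all $a\in A$, where $\varphi_1\colon A\to B$ is an isomorphism of $\mathbb{F}$-algebras, or $\varphi(a)=X\varphi_2(a)Y$ for all $a\in A$, where $\varphi_2\colon A\to B$ is an anti-isomorphism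 of $\mathbb{F}$-algebras (a bijective $\mathbb{F}$-linear map with $\varphi_2(ab)=\varphi_2(b)\varphi_2(a)$). -/

import Mathlib

namespace LocMat

/-- An associative algebra `A` (not necessarily unital) over a field `F` is *locally matrix* if
every finite subset of `A` is contained in a subalgebra isomorphic to a matrix algebra `M_n(F)`,
`n ≥ 1`. The isomorphism is a bijective map respecting addition, scalars and products. -/
def IsLocallyMatrix (F A : Type*) [Field F] [NonUnitalRing A] [Module F A]
    [IsScalarTower F A A] [SMulCommClass F A A] : Prop :=
  ∀ s : Finset A, ∃ n : ℕ, 1 ≤ n ∧ ∃ S : NonUnitalSubalgebra F A, (s : Set A) ⊆ S ∧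
    ∃ e : S →ₙₐ[F] Matrix (Fin n) (Fin n) F, Function.Bijective e

/-- `IsNormDet F a d` : the real number `d` is the value `|det a| ^ (1 / n)` computed in some
subalgebra `S ≅ M_n(F)`, `n ≥ 1`, of the unital algebra `A` that contains `1` and `a`
(a `Subalgebra` always contains `1`). -/
def IsNormDet (F : Type*) {A : Type*} [RCLike F] [Ring A] [Algebra F A] (a : A) (d : ℝ) : Prop :=
  ∃ n : ℕ, 1 ≤ n ∧ ∃ (S : Subalgebra F A) (e : S ≃ₐ[F] Matrix (Fin n) (Fin n) F) (ha : a ∈ S),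
    d = ‖(e ⟨a, ha⟩).det‖ ^ (1 / (n : ℝ))

/-- The normalized determinant of an element of a unital locally matrix algebra. That the value
exists and does not depend on the choice of the subalgebra and of the isomorphism is shown in
`existsUnique_isNormDet` below. -/
noncomputable def normDet (F : Type*) {A : Type*} [RCLike F] [Ring A] [Algebra F A] (a : A) : ℝ :=
  Classical.epsilon (IsNormDet F a)

/-- A map preserves the normalized determinant. -/
def PreservesNormDet (F : Type*) {A B : Type*} [RCLike F] [Ring A] [Algebra F A]
    [Ring B] [Algebra F B] (φ : A → B) : Prop :=
  ∀ a : A, normDet F (φ a) = normDet F a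

/-- In a unital locally matrix algebra the subalgebras can be chosen to contain `1`. -/
theorem IsLocallyMatrix.exists_subalgebra {F A : Type*} [Field F] [Ring A] [Algebra F A]
    (hA : IsLocallyMatrix F A) (s : Finset A) :
    ∃ n : ℕ, 1 ≤ n ∧ ∃ S : Subalgebra F A, (s : Set A) ⊆ S ∧
      Nonempty (S ≃ₐ[F] Matrix (Fin n) (Fin n) F) := by
  classical
  obtain ⟨n, hn, S, hs, e, he⟩ := hA (insert 1 s)
  have h1 : (1 : A) ∈ S := hs (by simp)
  refine ⟨n, hn, S.toSubalgebra h1, fun x hx => hs (by simp at hx; simp [hx]), ⟨?_⟩⟩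
  let u : S := ⟨1, h1⟩
  have hu : e u = 1 := by
    obtain ⟨v, hv⟩ := he.2 1
    have h2 : u * v = v := Subtype.ext (one_mul (v : A))
    have h3 := congrArg e h2
    rw [map_mul, hv, mul_one] at h3
    exact h3
  let f : S.toSubalgebra h1 →ₐ[F] Matrix (Fin n) (Fin n) F := AlgHom.ofLinearMap
    { toFun := fun x => e ⟨x.1, x.2⟩
      map_add' := fun x y => map_add e ⟨x.1, x.2⟩ ⟨y.1, y.2⟩
      map_smul' := fun c x => map_smul e c ⟨x.1, x.2⟩ } hu
    (fun x y => map_mul e ⟨x.1, x.2⟩ ⟨y.1, y.2⟩)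
  refine AlgEquiv.ofBijective f ⟨fun x y h => ?_, fun y => ?_⟩
  · have := he.1 (show e ⟨x.1, x.2⟩ = e ⟨y.1, y.2⟩ from h)
    exact Subtype.ext (congrArg Subtype.val this)
  · obtain ⟨x, hx⟩ := he.2 y
    exact ⟨⟨x.1, x.2⟩, hx⟩

/-- A unital homomorphism `f : M_n(F) → M_k(F)` satisfies `det (f a) ^ n = det a ^ k`. -/
theorem det_algHom_pow {F : Type*} [Field F] [CharZero F] {n k : ℕ}
    (f : Matrix (Fin n) (Fin n) F →ₐ[F] Matrix (Fin k) (Fin k) F)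
    (a : Matrix (Fin n) (Fin n) F) : (f a).det ^ n = a.det ^ k := by
  classical
  rcases Nat.eq_zero_or_pos n with rfl | hn
  · rw [Matrix.det_fin_zero, one_pow, pow_zero]
  let g : Fin n → F → F := fun i c => (f (Matrix.diagonal (Function.update 1 i c))).det
  let i₀ : Fin n := ⟨0, hn⟩
  have gmul : ∀ i c d, g i (c * d) = g i c * g i d := by
    intro i c d
    simp only [g]
    rw [← Matrix.det_mul, ← map_mul, Matrix.diagonal_mul_diagonal]
    congr 3
    ext j
    by_cases h : j = i
    · subst h; simp
    · simp [Function.update_of_ne h]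
  have gone : ∀ i, g i 1 = 1 := by
    intro i
    have : Function.update (1 : Fin n → F) i 1 = 1 := Function.update_eq_self i 1
    simp only [g]
    rw [this]
    simp
  have gsymm : ∀ i j c, g i c = g j c := by
    intro i j c
    let P : Matrix (Fin n) (Fin n) F := (Equiv.swap i j).permMatrix F
    have hPP : P * P = 1 := by
      simp only [P]
      rw [← Matrix.permMatrix_mul]
      simp
    have hc : P * Matrix.diagonal (Function.update 1 i c) * P
        = Matrix.diagonal (Function.update 1 j c) := by
      ext x y
      simp only [P, Equiv.Perm.permMatrix, PEquiv.toMatrix_toPEquiv_mul,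
        PEquiv.mul_toMatrix_toPEquiv, Matrix.submatrix_apply, Matrix.diagonal_apply, id]
      simp only [Function.update_apply, Equiv.symm_swap, (Equiv.swap i j).injective.eq_iff]
      have : Equiv.swap i j x = i ↔ x = j := by
        rw [Equiv.swap_apply_eq_iff]; simp
      simp [this]
    simp only [g]
    rw [← hc, map_mul, map_mul, Matrix.det_mul, Matrix.det_mul]
    have : (f P).det * (f P).det = 1 := by
      rw [← Matrix.det_mul, ← map_mul, hPP, map_one, Matrix.det_one]
    linear_combination (-1 * (f (Matrix.diagonal (Function.update 1 i c))).det) * this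
  let G : F →* F := ⟨⟨g i₀, gone i₀⟩, gmul i₀⟩
  have hdiag : ∀ D : Fin n → F, (f (Matrix.diagonal D)).det = G (∏ i, D i) := by
    intro D
    rw [map_prod]
    have h : ∀ s : Finset (Fin n),
        (f (Matrix.diagonal (fun i => if i ∈ s then D i else 1))).det = ∏ i ∈ s, G (D i) := by
      intro s
      induction s using Finset.induction_on with
      | empty => simp
      | insert i s hi ih =>
        rw [Finset.prod_insert hi, ← ih]
        change _ = g i₀ (D i) * _
        rw [gsymm i₀ i]
        simp only [g]
        rw [← Matrix.det_mul, ← map_mul, Matrix.diagonal_mul_diagonal]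
        congr 3
        ext j
        by_cases h : j = i
        · subst h; simp [hi]
        · simp [Function.update_of_ne h, h]
    simpa using h Finset.univ
  have hG : ∀ c : F, G c ^ n = c ^ k := by
    intro c
    have h := hdiag (fun _ => c)
    rw [Finset.prod_const, map_pow, Finset.card_univ, Fintype.card_fin] at h
    rw [← h]
    have : Matrix.diagonal (fun _ : Fin n => c) = algebraMap F (Matrix (Fin n) (Fin n) F) c := by
      rw [Matrix.algebraMap_eq_diagonal]; rfl
    rw [this, AlgHom.commutes, Matrix.algebraMap_eq_diagonal, Matrix.det_diagonal]
    simp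
  refine Matrix.diagonal_transvection_induction
    (fun M => (f M).det ^ n = M.det ^ k) a ?_ ?_ ?_
  · intro D _
    rw [hdiag, hG, Matrix.det_diagonal]
  · intro t
    rcases t with ⟨i, j, hij, c⟩
    have hT : ∀ c d : F, (f (Matrix.transvection i j (c + d))).det
        = (f (Matrix.transvection i j c)).det * (f (Matrix.transvection i j d)).det := by
      intro c d
      rw [← Matrix.det_mul, ← map_mul, Matrix.transvection_mul_transvection_same i j hij]
    let D : Matrix (Fin n) (Fin n) F := Matrix.diagonal (Function.update 1 i 2)
    let D' : Matrix (Fin n) (Fin n) F := Matrix.diagonal (Function.update 1 i 2⁻¹)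
    have hDD : D * D' = 1 := by
      simp only [D, D']
      rw [Matrix.diagonal_mul_diagonal, ← Matrix.diagonal_one]
      congr 1
      ext x
      by_cases h : x = i
      · subst h; simp
      · simp [Function.update_of_ne h]
    have hconj : D * Matrix.transvection i j c = Matrix.transvection i j (c + c) * D := by
      simp only [D, Matrix.transvection, mul_add, add_mul, mul_one, one_mul]
      congr 1
      ext x y
      rw [Matrix.diagonal_mul, Matrix.mul_diagonal]
      by_cases hx : i = x
      · by_cases hy : j = y
        · subst hx; subst hy
          simp [Function.update_of_ne (Ne.symm hij)]
          ring
        · simp [Matrix.single_apply, hy]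
      · simp [Matrix.single_apply, hx]
    have hD : (f D).det ≠ 0 := by
      intro h0
      have := congrArg (fun M => (f M).det) hDD
      simp [h0] at this
    have h1 := congrArg (fun M => (f M).det) hconj
    simp only [map_mul, Matrix.det_mul] at h1
    have h2 : (f (Matrix.transvection i j (c + c))).det = (f (Matrix.transvection i j c)).det :=
      mul_right_cancel₀ hD (by rw [← h1, mul_comm])
    have h3 : (f (Matrix.transvection i j c)).det ≠ 0 := by
      intro h0
      have h4 := hT c (-c)
      simp [h0] at h4
    have h5 : (f (Matrix.transvection i j c)).det = 1 := by
      rw [hT] at h2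
      exact mul_left_cancel₀ h3 (by rw [h2, mul_one])
    change (f (Matrix.transvection i j c)).det ^ n = (Matrix.transvection i j c).det ^ k
    rw [h5, Matrix.det_transvection_of_ne i j hij, one_pow, one_pow]
  · intro M N hM hN
    rw [map_mul, Matrix.det_mul, Matrix.det_mul, mul_pow, mul_pow, hM, hN]

/-- The normalized determinant is well defined on a unital locally matrix algebra. -/
theorem existsUnique_isNormDet {F A : Type*} [RCLike F] [Ring A] [Algebra F A]
    (hA : IsLocallyMatrix F A) (a : A) : ∃! d : ℝ, IsNormDet F a d := by
  classical
  have key : ∀ (n k : ℕ), 1 ≤ n → 1 ≤ k → ∀ (S T : Subalgebra F A)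
      (e : S ≃ₐ[F] Matrix (Fin n) (Fin n) F) (g : T ≃ₐ[F] Matrix (Fin k) (Fin k) F) (_ : S ≤ T)
      (ha : a ∈ S) (hb : a ∈ T),
      ‖(e ⟨a, ha⟩).det‖ ^ (1 / (n : ℝ)) = ‖(g ⟨a, hb⟩).det‖ ^ (1 / (k : ℝ)) := by
    intro n k hn hk S T e g hST ha hb
    have h := det_algHom_pow ((g.toAlgHom.comp (Subalgebra.inclusion hST)).comp e.symm.toAlgHom)
      (e ⟨a, ha⟩)
    have h' : ((g.toAlgHom.comp (Subalgebra.inclusion hST)).comp e.symm.toAlgHom) (e ⟨a, ha⟩)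
        = g ⟨a, hb⟩ := by
      simp
    rw [h'] at h
    have h2 := congrArg norm h
    rw [norm_pow, norm_pow] at h2
    set x := ‖(e ⟨a, ha⟩).det‖
    set y := ‖(g ⟨a, hb⟩).det‖
    have hx : 0 ≤ x := norm_nonneg _
    have hy : 0 ≤ y := norm_nonneg _
    have hn' : (n : ℝ) ≠ 0 := by positivity
    have hk' : (k : ℝ) ≠ 0 := by positivity
    have hx2 : x = (y ^ n) ^ (1 / (k : ℝ)) := by
      rw [h2, one_div, Real.pow_rpow_inv_natCast hx (by omega)]
    rw [hx2, ← Real.rpow_natCast, ← Real.rpow_mul hy, ← Real.rpow_mul hy]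
    congr 1
    field_simp
  have span : ∀ (n : ℕ) (S : Subalgebra F A) (_ : S ≃ₐ[F] Matrix (Fin n) (Fin n) F),
      ∃ s : Finset A, ∀ T : Subalgebra F A, (s : Set A) ⊆ T → S ≤ T := by
    intro n S e
    refine ⟨Finset.univ.image (fun p : Fin n × Fin n =>
      ((e.symm (Matrix.single p.1 p.2 1) : S) : A)), fun T hT x hx => ?_⟩
    have h1 : x = ∑ i, ∑ j, (e ⟨x, hx⟩) i j • ((e.symm (Matrix.single i j 1) : S) : A) := by
      have h2 : (⟨x, hx⟩ : S) = e.symm (e ⟨x, hx⟩) := by simp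
      conv_lhs => rw [show x = ((⟨x, hx⟩ : S) : A) from rfl, h2,
        Matrix.matrix_eq_sum_single (e ⟨x, hx⟩)]
      simp only [map_sum, AddSubmonoidClass.coe_finsetSum]
      refine Finset.sum_congr rfl fun i _ => Finset.sum_congr rfl fun j _ => ?_
      rw [← Subalgebra.coe_smul, ← map_smul, Matrix.smul_single, smul_eq_mul, mul_one]
    rw [h1]
    refine sum_mem fun i _ => sum_mem fun j _ => T.smul_mem (hT ?_) _
    simp
  obtain ⟨n, hn, S, hS, ⟨e⟩⟩ := hA.exists_subalgebra {a}
  have ha : a ∈ S := hS (by simp)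
  refine ⟨_, ⟨n, hn, S, e, ha, rfl⟩, ?_⟩
  rintro d ⟨m, hm, S', e', ha', rfl⟩
  obtain ⟨s, hs⟩ := span n S e
  obtain ⟨s', hs'⟩ := span m S' e'
  obtain ⟨k, hk, T, hT, ⟨g⟩⟩ := hA.exists_subalgebra (s ∪ s')
  rw [Finset.coe_union, Set.union_subset_iff] at hT
  have hST := hs T hT.1
  have hST' := hs' T hT.2
  rw [key n k hn hk S T e g hST ha (hST ha), key m k hm hk S' T e' g hST' ha' (hST ha)]

/-- `normDet` computes `|det a| ^ (1 / n)` in every subalgebra `S ≅ M_n(F)` containing `1, a`. -/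
theorem normDet_eq {F A : Type*} [RCLike F] [Ring A] [Algebra F A] (hA : IsLocallyMatrix F A)
    {n : ℕ} (hn : 1 ≤ n) (S : Subalgebra F A) (e : S ≃ₐ[F] Matrix (Fin n) (Fin n) F)
    {a : A} (ha : a ∈ S) : normDet F a = ‖(e ⟨a, ha⟩).det‖ ^ (1 / (n : ℝ)) := by
  have h := existsUnique_isNormDet hA a
  exact h.unique (Classical.epsilon_spec h.exists) ⟨n, hn, S, e, ha, rfl⟩

end LocMat

/-! With `X = φ 1`, a unit of normalized determinant 1, the map `ψ = X⁻¹ φ` is unital and still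
preserves the normalized determinant, so one can take `Y = 1` and must show that `ψ` is
multiplicative or antimultiplicative.

The determinant carries a trace form: its derivative at a unit `b` in the direction `a` is `normDet
b` times Re tr(b⁻¹a), where tr is the normalized trace. Hence `ψ` preserves Re tr(b⁻¹a)
(`reTrace_inverse_mul_map`), and differentiating again along `b = 1 + s x` shows that it preserves
Re tr(xa) (`reTrace_map_mul_map`). This form is nondegenerate, so `ψ` is injective and, being
surjective, commutes with inversion. Hua's identity turns this into ψ(x²) = ψ(x)². Finally, a
locally matrix algebra is prime, and a Jordan homomorphism onto a prime ring without 2-torsion is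
multiplicative or antimultiplicative (Herstein). -/

namespace LocMat

/-! ### Jordan homomorphisms onto prime rings -/

/-- In a prime ring without 2-torsion, `α x β + β x α = 0` for all `x` forces `α = 0` or `β = 0`. -/
theorem eq_zero_or_eq_zero_of_anticomm {R : Type*} [Ring R]
    (prime : ∀ a b : R, (∀ x, a * x * b = 0) → a = 0 ∨ b = 0)
    (two : ∀ a : R, a + a = 0 → a = 0) (a b : R)
    (h : ∀ x, a * x * b + b * x * a = 0) : a = 0 ∨ b = 0 := by
  have hn : ∀ x, b * x * a = -(a * x * b) := fun x => by
    rw [eq_neg_iff_add_eq_zero, add_comm]; exact h x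
  refine prime a b fun x => ?_
  -- With c = axb, moving `a` and `b` past each other in two ways gives both cyc = -(axaybxb) and
  -- axaybxb = cyc, so 2cyc = 0; primeness then kills c.
  have key : ∀ y, a * x * b * y * (a * x * b) = 0 := fun y => by
    apply two
    have h1 : a * x * b * y * (a * x * b) = -(a * x * a * y * b * x * b) := by
      have := hn y
      calc a * x * b * y * (a * x * b) = a * x * (b * y * a) * x * b := by noncomm_ring
        _ = -(a * x * a * y * b * x * b) := by rw [this]; noncomm_ring
    have h2 : a * x * a * y * b * x * b = a * x * b * y * (a * x * b) := by
      have e1 : a * (x * a * y) * b = -(b * (x * a * y) * a) := by rw [hn, neg_neg]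
      calc a * x * a * y * b * x * b = (a * (x * a * y) * b) * x * b := by noncomm_ring
        _ = -((b * x * a) * y * (a * x * b)) := by rw [e1]; noncomm_ring
        _ = _ := by rw [hn x]; noncomm_ring
    rw [h2] at h1
    nth_rewrite 1 [h1]
    exact neg_add_cancel _
  exact (prime _ _ key).elim id id

/-- If two biadditive maps have no common pair of non-zero values, then one of them vanishes. -/
theorem forall_eq_zero_or_forall_eq_zero {M N P : Type*} [AddCommGroup M] [AddCommGroup N]
    [AddCommGroup P] (f g : M →+ N →+ P) (h : ∀ a b, f a b = 0 ∨ g a b = 0) :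
    (∀ a b, f a b = 0) ∨ (∀ a b, g a b = 0) := by
  -- A group is not the union of two proper subgroups. This is used first for the kernels of `f a`
  -- and `g a` in `N`, then for the kernels of `f` and `g` in `M`.
  have row : ∀ a, (∀ b, f a b = 0) ∨ (∀ b, g a b = 0) := by
    intro a
    by_contra! ⟨⟨b, hb⟩, ⟨c, hc⟩⟩
    have hb' := (h a b).resolve_left hb
    have hc' := (h a c).resolve_right hc
    rcases h a (b + c) with h1 | h1 <;> simp_all
  by_contra! ⟨⟨a, b, hab⟩, ⟨c, d, hcd⟩⟩
  have ha := (row a).resolve_left fun h => hab (h b)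
  have hc := (row c).resolve_right fun h => hcd (h d)
  rcases row (a + c) with h1 | h1
  · exact hab (by simpa [hc] using h1 b)
  · exact hcd (by simpa [ha] using h1 d)

/-- A surjective Jordan homomorphism onto a prime ring without 2-torsion is multiplicative
or antimultiplicative. -/
theorem mul_or_antimul_of_jordan {R S : Type*} [Ring R] [Ring S]
    (prime : ∀ a b : S, (∀ x, a * x * b = 0) → a = 0 ∨ b = 0)
    (two : ∀ a : S, a + a = 0 → a = 0) (ψ : R →+ S) (hψ : Function.Surjective ψ)
    (sq : ∀ x, ψ (x * x) = ψ x * ψ x) :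
    (∀ a b, ψ (a * b) = ψ a * ψ b) ∨ (∀ a b, ψ (a * b) = ψ b * ψ a) := by
  have jordan : ∀ a b, ψ (a * b) + ψ (b * a) = ψ a * ψ b + ψ b * ψ a := fun a b => by
    have h := sq (a + b)
    simp only [add_mul, mul_add, map_add, sq] at h
    have : ψ (a * b) + ψ (b * a) - (ψ a * ψ b + ψ b * ψ a) = 0 := by
      rw [← sub_eq_zero] at h
      rw [← h]; abel
    exact sub_eq_zero.1 this
  -- With the Jordan product a∘b = ab + ba, one has a∘(a∘b) = a²∘b + 2aba; the factor 2 is then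
  -- cancelled.
  have inner : ∀ a b, ψ (a * b * a) = ψ a * ψ b * ψ a := fun a b => by
    have h2 := jordan (a * a) b
    rw [sq] at h2
    have h3 : ψ (a * (a * b) + a * (b * a)) + ψ (a * b * a + b * a * a)
        = ψ a * (ψ a * ψ b + ψ b * ψ a) + (ψ a * ψ b + ψ b * ψ a) * ψ a := by
      have := jordan a (a * b + b * a)
      rw [mul_add, add_mul, map_add ψ (a * b), jordan] at this
      exact this
    rw [← sub_eq_zero]
    apply two
    have e : a * (a * b) + a * (b * a) + (a * b * a + b * a * a)
        = (a * a * b + b * (a * a)) + (a * b * a + a * b * a) := by noncomm_ring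
    rw [← map_add, e, map_add, map_add, map_add, h2] at h3
    rw [← sub_eq_zero] at h3
    rw [← h3]; noncomm_ring
  have triple : ∀ a b c, ψ (a * b * c) + ψ (c * b * a) = ψ a * ψ b * ψ c + ψ c * ψ b * ψ a :=
    fun a b c => by
      have h := inner (a + c) b
      have e : (a + c) * b * (a + c)
        = a * b * a + c * b * c + (a * b * c + c * b * a) := by noncomm_ring
      rw [e, map_add, map_add, map_add, inner, inner, map_add] at h
      rw [← sub_eq_zero] at h ⊢
      rw [← h]; noncomm_ring
  let f : R →+ R →+ S := AddMonoidHom.mk' (fun a => AddMonoidHom.mk'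
    (fun b => ψ (a * b) - ψ a * ψ b) (fun b c => by simp only [mul_add, map_add]; abel))
    (fun a b => by ext c; simp [add_mul]; abel)
  let g : R →+ R →+ S := AddMonoidHom.mk' (fun a => AddMonoidHom.mk'
    (fun b => ψ (a * b) - ψ b * ψ a) (fun b c => by simp only [mul_add, add_mul, map_add]; abel))
    (fun a b => by ext c; simp [add_mul, mul_add]; abel)
  -- `f` and `g` measure the failure of multiplicativity and antimultiplicativity. Evaluating
  -- ψ(abxba + baxab) by `triple` and by `inner` shows that their values anticommute around every
  -- ψ(x).
  have hfg := forall_eq_zero_or_forall_eq_zero f g fun a b => by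
    refine eq_zero_or_eq_zero_of_anticomm prime two _ _ fun y => ?_
    obtain ⟨x, rfl⟩ := hψ y
    have h1 := triple (a * b) x (b * a)
    have h2 : ψ (b * a) = ψ a * ψ b + ψ b * ψ a - ψ (a * b) := by rw [← jordan]; abel
    have e1 : a * b * x * (b * a) = a * (b * x * b) * a := by noncomm_ring
    have e2 : b * a * x * (a * b) = b * (a * x * a) * b := by noncomm_ring
    rw [e1, e2, inner, inner, inner, inner, h2, ← sub_eq_zero] at h1
    change (ψ (a * b) - ψ a * ψ b) * ψ x * (ψ (a * b) - ψ b * ψ a)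
      + (ψ (a * b) - ψ b * ψ a) * ψ x * (ψ (a * b) - ψ a * ψ b) = 0
    rw [← h1]; noncomm_ring
  exact hfg.imp (fun h a b => sub_eq_zero.1 (h a b)) (fun h a b => sub_eq_zero.1 (h a b))

end LocMat
-- Determinant, units and primeness in matrix coordinates
namespace LocMat

open Filter Topology

section Embedding

variable {F A : Type*} [RCLike F] [Ring A] [Algebra F A]

/-- In a unital locally matrix algebra, finitely many elements lie in the image of a unital
embedding of a matrix algebra. -/
theorem IsLocallyMatrix.exists_embedding (hA : IsLocallyMatrix F A) (s : Finset A) :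
    ∃ n : ℕ, 1 ≤ n ∧ ∃ j : Matrix (Fin n) (Fin n) F →ₐ[F] A, Function.Injective j ∧
      ∀ a ∈ s, ∃ M, j M = a := by
  obtain ⟨n, hn, S, hS, ⟨e⟩⟩ := hA.exists_subalgebra s
  exact ⟨n, hn, S.val.comp e.symm.toAlgHom, Subtype.val_injective.comp e.symm.injective,
    fun a ha => ⟨e ⟨a, hS ha⟩, by simp⟩⟩

variable {n : ℕ} {j : Matrix (Fin n) (Fin n) F →ₐ[F] A}

theorem normDet_embedding (hA : IsLocallyMatrix F A) (hn : 1 ≤ n) (hj : Function.Injective j)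
    (M : Matrix (Fin n) (Fin n) F) : normDet F (j M) = ‖M.det‖ ^ (1 / (n : ℝ)) := by
  refine (normDet_eq hA hn j.range (AlgEquiv.ofInjective j hj).symm ⟨M, rfl⟩).trans ?_
  have : (AlgEquiv.ofInjective j hj).symm ⟨j M, ⟨M, rfl⟩⟩ = M := by
    rw [AlgEquiv.symm_apply_eq]; rfl
  exact congrArg (fun N => ‖Matrix.det N‖ ^ (1 / (n : ℝ))) this

theorem normDet_one (hA : IsLocallyMatrix F A) : normDet F (1 : A) = 1 := by
  obtain ⟨n, hn, j, hj, -⟩ := hA.exists_embedding ∅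
  rw [← map_one j, normDet_embedding hA hn hj]
  simp

theorem normDet_mul (hA : IsLocallyMatrix F A) (a b : A) :
    normDet F (a * b) = normDet F a * normDet F b := by
  classical
  obtain ⟨n, hn, j, hj, h⟩ := hA.exists_embedding {a, b}
  obtain ⟨M, rfl⟩ := h a (by simp)
  obtain ⟨N, rfl⟩ := h b (by simp)
  simp only [← map_mul, normDet_embedding hA hn hj, Matrix.det_mul, norm_mul]
  exact Real.mul_rpow (norm_nonneg _) (norm_nonneg _)

theorem isUnit_iff_normDet_ne_zero (hA : IsLocallyMatrix F A) (a : A) :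
    IsUnit a ↔ normDet F a ≠ 0 := by
  constructor
  · rintro ⟨u, rfl⟩ h0
    have h := normDet_mul hA (u : A) ((u⁻¹ : Aˣ) : A)
    rw [Units.mul_inv, normDet_one hA, h0, zero_mul] at h
    exact one_ne_zero h
  · intro h
    obtain ⟨n, hn, j, hj, hs⟩ := hA.exists_embedding {a}
    obtain ⟨M, rfl⟩ := hs a (by simp)
    rw [normDet_embedding hA hn hj] at h
    refine IsUnit.map j ((Matrix.isUnit_iff_isUnit_det M).2 (isUnit_iff_ne_zero.2 fun h0 => h ?_))
    rw [h0, norm_zero, Real.zero_rpow]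
    have : (n : ℝ) ≠ 0 := by positivity
    positivity

theorem isUnit_embedding_iff (hA : IsLocallyMatrix F A) (hn : 1 ≤ n) (hj : Function.Injective j)
    (M : Matrix (Fin n) (Fin n) F) : IsUnit (j M) ↔ IsUnit M := by
  refine ⟨fun h => ?_, fun h => h.map j⟩
  rw [isUnit_iff_normDet_ne_zero hA, normDet_embedding hA hn hj] at h
  refine (Matrix.isUnit_iff_isUnit_det M).2 (isUnit_iff_ne_zero.2 fun h0 => h ?_)
  rw [h0, norm_zero, Real.zero_rpow]
  have : (n : ℝ) ≠ 0 := by positivity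
  positivity

theorem ringInverse_embedding (hA : IsLocallyMatrix F A) (hn : 1 ≤ n)
    (hj : Function.Injective j) (M : Matrix (Fin n) (Fin n) F) :
    Ring.inverse (j M) = j (Ring.inverse M) := by
  by_cases hM : IsUnit M
  · obtain ⟨u, rfl⟩ := hM
    rw [Ring.inverse_unit]
    exact Ring.inverse_unit (Units.map (j : Matrix (Fin n) (Fin n) F →* A) u)
  · rw [Ring.inverse_non_unit _ hM, map_zero,
      Ring.inverse_non_unit _ (mt (isUnit_embedding_iff hA hn hj M).1 hM)]

/-- A unital locally matrix algebra is a prime ring. -/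
theorem IsLocallyMatrix.eq_zero_or_eq_zero (hA : IsLocallyMatrix F A) (a b : A)
    (h : ∀ x, a * x * b = 0) : a = 0 ∨ b = 0 := by
  classical
  obtain ⟨n, hn, j, hj, hs⟩ := hA.exists_embedding {a, b}
  obtain ⟨M, rfl⟩ := hs a (by simp)
  obtain ⟨N, rfl⟩ := hs b (by simp)
  have h' : ∀ X, M * X * N = 0 := fun X => hj (by rw [map_mul, map_mul, h, map_zero])
  by_contra! ⟨hM, hN⟩
  suffices hM0 : M = 0 from hM (by rw [hM0, map_zero])
  ext p q
  by_contra hpq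
  suffices hN0 : N = 0 from hN (by rw [hN0, map_zero])
  ext r s
  -- The (p, s) entry of M E_qr N is M_pq N_rs.
  have := congrFun (congrFun (h' (Matrix.single q r 1)) p) s
  rw [Matrix.mul_assoc, Matrix.mul_apply, Finset.sum_eq_single q] at this
  · rw [Matrix.single_mul_apply_same] at this
    simpa using (mul_eq_zero.1 this).resolve_left hpq
  · intro k _ hk
    rw [Matrix.single_mul_apply_of_ne _ _ _ _ _ hk, mul_zero]
  · simp

/-- All but finitely many scalar translates of an element are invertible. -/
theorem finite_setOf_not_isUnit_add_smul_one (hA : IsLocallyMatrix F A) (a : A) :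
    {c : F | ¬ IsUnit (a + c • (1 : A))}.Finite := by
  obtain ⟨n, hn, j, hj, hs⟩ := hA.exists_embedding {a}
  obtain ⟨M, rfl⟩ := hs a (by simp)
  -- The bad scalars are the eigenvalues of -M.
  have hp : (-M).charpoly ≠ 0 := (Matrix.charpoly_monic _).ne_zero
  refine ((-M).charpoly.rootSet_finite F).subset fun c hc => ?_
  rw [Polynomial.mem_rootSet_of_ne hp, Polynomial.coe_aeval_eq_eval, Matrix.eval_charpoly]
  by_contra h0
  refine hc ?_
  rw [show j M + c • (1 : A) = j (Matrix.scalar (Fin n) c - -M) from ?_]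
  · exact ((Matrix.isUnit_iff_isUnit_det _).2 (isUnit_iff_ne_zero.2 h0)).map j
  · rw [sub_neg_eq_add, add_comm, map_add, ← map_one j, ← map_smul, Matrix.scalar_apply,
      Matrix.smul_one_eq_diagonal]

end Embedding

/-! ### The trace form as a derivative of the determinant -/

section ReTrace

variable {F A : Type*} [RCLike F] [Ring A] [Algebra F A]

/-- The derivative of the normalized determinant at `1` in the direction `a`. It is the real part
of the normalized trace of `a`. -/
noncomputable def reTrace (F : Type*) {A : Type*} [RCLike F] [Ring A] [Algebra F A] (a : A) : ℝ :=
  deriv (fun t : ℝ => normDet F (1 + (t : F) • a)) 0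

/-- det(1 + tM) = 1 + t tr M + O(t²), and the modulus sees only the real part of the linear term. -/
theorem hasDerivAt_norm_det_one_add_smul {n : ℕ} (M : Matrix (Fin n) (Fin n) F) :
    HasDerivAt (fun t : ℝ => ‖(1 + (t : F) • M).det‖ ^ (1 / (n : ℝ)))
      (RCLike.re M.trace / n) 0 := by
  have hF : HasDerivAt (fun t : F => (1 + t • M).det) M.trace 0 := by
    set r := (Matrix.det (1 + (Polynomial.X : Polynomial F) • M.map Polynomial.C)).divX.divX
    have h : (fun t : F => (1 + t • M).det) = fun t => 1 + M.trace * t + r.eval t * t ^ 2 :=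
      funext fun t => Matrix.det_one_add_smul t M
    rw [h]
    have h1 := (((hasDerivAt_id (0 : F)).const_mul M.trace).const_add 1).add
      ((r.hasDerivAt 0).mul ((hasDerivAt_id (0 : F)).pow 2))
    refine h1.congr_deriv ?_
    simp
  have hd : HasDerivAt (fun t : ℝ => (1 + (t : F) • M).det) M.trace 0 := by
    have h0 : HasDerivAt (fun t : ℝ => (t : F)) 1 0 := by
      have := (RCLike.ofRealCLM (K := F)).hasDerivAt (x := (0 : ℝ))
      simpa using this
    have hF' : HasDerivAt (fun t : F => (1 + t • M).det) M.trace ((0 : ℝ) : F) := by simpa using hF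
    exact (hF'.scomp (0 : ℝ) h0).congr_deriv (one_smul _ _)
  have hre := ((RCLike.reCLM (K := F)).hasFDerivAt.comp_hasDerivAt (0 : ℝ) hd)
  have him := ((RCLike.imCLM (K := F)).hasFDerivAt.comp_hasDerivAt (0 : ℝ) hd)
  have hsq := (hre.mul hre).add (him.mul him)
  -- The exponent is halved because the base is the squared modulus re² + im², which is
  -- differentiable and equals 1 at t = 0.
  have hp := hsq.rpow_const (p := 1 / (n : ℝ) / 2) (Or.inl (by simp))
  have hfun : (fun t : ℝ => ‖(1 + (t : F) • M).det‖ ^ (1 / (n : ℝ))) = fun t : ℝ =>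
      (RCLike.re (1 + (t : F) • M).det * RCLike.re (1 + (t : F) • M).det
        + RCLike.im (1 + (t : F) • M).det * RCLike.im (1 + (t : F) • M).det)
        ^ (1 / (n : ℝ) / 2) := by
    funext t
    rw [← RCLike.normSq_apply, RCLike.normSq_eq_def', ← Real.rpow_natCast,
      ← Real.rpow_mul (norm_nonneg _)]
    congr 1
    push_cast; ring
  rw [hfun]
  refine hp.congr_deriv ?_
  simp
  ring

variable {n : ℕ} {j : Matrix (Fin n) (Fin n) F →ₐ[F] A}

theorem hasDerivAt_normDet_embedding (hA : IsLocallyMatrix F A) (hn : 1 ≤ n)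
    (hj : Function.Injective j) (M : Matrix (Fin n) (Fin n) F) :
    HasDerivAt (fun t : ℝ => normDet F (1 + (t : F) • j M)) (RCLike.re M.trace / n) 0 := by
  have h : (fun t : ℝ => normDet F (1 + (t : F) • j M))
      = fun t : ℝ => ‖(1 + (t : F) • M).det‖ ^ (1 / (n : ℝ)) := by
    funext t
    rw [← normDet_embedding hA hn hj, map_add, map_one, map_smul]
  rw [h]
  exact hasDerivAt_norm_det_one_add_smul M

theorem reTrace_embedding (hA : IsLocallyMatrix F A) (hn : 1 ≤ n)
    (hj : Function.Injective j) (M : Matrix (Fin n) (Fin n) F) :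
    reTrace F (j M) = RCLike.re M.trace / n :=
  (hasDerivAt_normDet_embedding hA hn hj M).deriv

theorem reTrace_add (hA : IsLocallyMatrix F A) (a b : A) :
    reTrace F (a + b) = reTrace F a + reTrace F b := by
  classical
  obtain ⟨n, hn, j, hj, hs⟩ := hA.exists_embedding {a, b}
  obtain ⟨M, rfl⟩ := hs a (by simp)
  obtain ⟨N, rfl⟩ := hs b (by simp)
  rw [← map_add, reTrace_embedding hA hn hj, reTrace_embedding hA hn hj,
    reTrace_embedding hA hn hj, Matrix.trace_add, map_add, add_div]

/-- The pairing `(a, x) ↦ reTrace (a * x)` is nondegenerate. -/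
theorem eq_zero_of_reTrace_mul_eq_zero (hA : IsLocallyMatrix F A) (a : A)
    (h : ∀ x, reTrace F (a * x) = 0) : a = 0 := by
  obtain ⟨n, hn, j, hj, hs⟩ := hA.exists_embedding {a}
  obtain ⟨M, rfl⟩ := hs a (by simp)
  -- Testing against M* gives the squared Frobenius norm of M, up to the factor 1/n.
  have h1 := h (j M.conjTranspose)
  rw [← map_mul, reTrace_embedding hA hn hj, div_eq_zero_iff] at h1
  have h2 : RCLike.re (M * M.conjTranspose).trace = 0 :=
    h1.resolve_right (by positivity)
  have h3 : RCLike.re (M * M.conjTranspose).trace = ∑ p, ∑ q, ‖M p q‖ ^ 2 := by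
    simp only [Matrix.trace, Matrix.diag_apply, Matrix.mul_apply, Matrix.conjTranspose_apply,
      map_sum]
    refine Finset.sum_congr rfl fun p _ => Finset.sum_congr rfl fun q _ => ?_
    rw [RCLike.star_def, RCLike.mul_conj]
    norm_cast
  rw [h3, Finset.sum_eq_zero_iff_of_nonneg fun p _ => Finset.sum_nonneg fun q _ => sq_nonneg _]
    at h2
  rw [show M = 0 from ?_, map_zero]
  ext p q
  have h4 := h2 p (Finset.mem_univ p)
  rw [Finset.sum_eq_zero_iff_of_nonneg fun q _ => sq_nonneg _] at h4
  simpa using h4 q (Finset.mem_univ q)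

theorem eq_of_reTrace_mul_eq (hA : IsLocallyMatrix F A) {a b : A}
    (h : ∀ x, reTrace F (a * x) = reTrace F (b * x)) : a = b := by
  rw [← sub_eq_zero]
  refine eq_zero_of_reTrace_mul_eq_zero hA _ fun x => ?_
  have := reTrace_add hA ((a - b) * x) (b * x)
  rw [← add_mul, sub_add_cancel, h] at this
  linarith

/-- Inversion has derivative -id at 1. Both elements lie in one matrix algebra, where an auxiliary
Banach algebra norm gives this. -/
theorem hasDerivAt_reTrace_ringInverse (hA : IsLocallyMatrix F A) (x a : A) :
    HasDerivAt (fun s : ℝ => reTrace F (Ring.inverse (1 + (s : F) • x) * a))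
      (-reTrace F (x * a)) 0 := by
  classical
  obtain ⟨n, hn, j, hj, hs⟩ := hA.exists_embedding {x, a}
  obtain ⟨X, rfl⟩ := hs x (by simp)
  obtain ⟨M, rfl⟩ := hs a (by simp)
  have h : ∀ s : ℝ, Ring.inverse (1 + (s : F) • j X) * j M
      = j (Ring.inverse (1 + (s : F) • X) * M) := fun s => by
    rw [map_mul, ← ringInverse_embedding hA hn hj, map_add, map_one, map_smul]
  simp only [h, ← map_mul, reTrace_embedding hA hn hj]
  let : NormedRing (Matrix (Fin n) (Fin n) F) := Matrix.linftyOpNormedRing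
  let : NormedAlgebra ℝ (Matrix (Fin n) (Fin n) F) := Matrix.linftyOpNormedAlgebra
  have : CompleteSpace (Matrix (Fin n) (Fin n) F) := FiniteDimensional.complete ℝ _
  have h1 : HasDerivAt (fun s : ℝ => 1 + (s : F) • X) X 0 := by
    have := ((hasDerivAt_id (0 : ℝ)).smul_const X).const_add 1
    rw [one_smul] at this
    refine this.congr_of_eventuallyEq (Eventually.of_forall fun s => congrArg (1 + ·) ?_)
    ext p q
    exact (RCLike.real_smul_eq_coe_mul s (X p q)).symm
  have h3 : HasDerivAt (fun s : ℝ => Ring.inverse (1 + (s : F) • X)) (-X) 0 := by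
    have h2 := hasFDerivAt_ringInverse (𝕜 := ℝ) (1 : (Matrix (Fin n) (Fin n) F)ˣ)
    rw [show ((1 : (Matrix (Fin n) (Fin n) F)ˣ) : Matrix (Fin n) (Fin n) F)
      = 1 + ((0 : ℝ) : F) • X by
        rw [RCLike.ofReal_zero, zero_smul, add_zero, Units.val_one]] at h2
    have := h2.comp_hasDerivAt (0 : ℝ) h1
    refine this.congr_deriv ?_
    simp
  let T : Matrix (Fin n) (Fin n) F →ₗ[ℝ] ℝ :=
    { toFun := fun N => RCLike.re (N * M).trace / n
      map_add' := fun N N' => by simp [add_mul, add_div]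
      map_smul' := fun c N => by
        simp [RCLike.real_smul_eq_coe_mul, mul_div_assoc] }
  have h4 := T.toContinuousLinearMap.hasFDerivAt.comp_hasDerivAt (0 : ℝ) h3
  refine h4.congr_deriv ?_
  change RCLike.re (-X * M).trace / n = _
  rw [neg_mul, Matrix.trace_neg, map_neg, neg_div]

end ReTrace

end LocMat
-- Unital determinant preservers are Jordan homomorphisms
namespace LocMat

section Preserver

variable {F A B : Type*} [RCLike F] [Ring A] [Algebra F A] [Ring B] [Algebra F B]

theorem isUnit_map_iff_of_preservesNormDet (hA : IsLocallyMatrix F A)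
    (hB : IsLocallyMatrix F B) {ψ : A → B} (hdet : PreservesNormDet F ψ) (a : A) :
    IsUnit (ψ a) ↔ IsUnit a := by
  rw [isUnit_iff_normDet_ne_zero hA, isUnit_iff_normDet_ne_zero hB, hdet]

theorem normDet_add_smul_of_isUnit (hA : IsLocallyMatrix F A) {b : A} (hb : IsUnit b) (a : A)
    (t : F) : normDet F (b + t • a)
      = normDet F b * normDet F (1 + t • (Ring.inverse b * a)) := by
  rw [← normDet_mul hA, mul_add, mul_one, mul_smul_comm, Ring.mul_inverse_cancel_left _ _ hb]

variable {ψ : A →ₗ[F] B}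

/-- For a unit `b` both sides are the logarithmic derivative of the same function t ↦ normDet(b +
ta) at 0. -/
theorem reTrace_inverse_mul_map (hA : IsLocallyMatrix F A) (hB : IsLocallyMatrix F B)
    (hdet : PreservesNormDet F ψ) (b a : A) :
    reTrace F (Ring.inverse (ψ b) * ψ a) = reTrace F (Ring.inverse b * a) := by
  by_cases hb : IsUnit b
  · have hb' := (isUnit_map_iff_of_preservesNormDet hA hB hdet b).2 hb
    refine congrArg (fun f : ℝ → ℝ => deriv f 0) (funext fun t => ?_)
    refine mul_left_cancel₀ ((isUnit_iff_normDet_ne_zero hA b).1 hb) ?_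
    rw [← normDet_add_smul_of_isUnit hA hb, ← hdet b, ← normDet_add_smul_of_isUnit hB hb',
      ← map_smul, ← map_add, hdet]
  -- At non-units `Ring.inverse` is 0 on both sides, so the identity holds for all `b` and no unit
  -- condition is carried along.
  · have hb' := mt (isUnit_map_iff_of_preservesNormDet hA hB hdet b).1 hb
    rw [Ring.inverse_non_unit _ hb, Ring.inverse_non_unit _ hb', zero_mul, zero_mul]
    simp [reTrace, normDet_one hA, normDet_one hB]

theorem reTrace_map_mul_map (hA : IsLocallyMatrix F A) (hB : IsLocallyMatrix F B)
    (hdet : PreservesNormDet F ψ) (hone : ψ 1 = 1) (x a : A) :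
    reTrace F (ψ x * ψ a) = reTrace F (x * a) := by
  have h1 := hasDerivAt_reTrace_ringInverse hA x a
  have h2 := hasDerivAt_reTrace_ringInverse hB (ψ x) (ψ a)
  have h : (fun s : ℝ => reTrace F (Ring.inverse (1 + (s : F) • ψ x) * ψ a))
      = fun s : ℝ => reTrace F (Ring.inverse (1 + (s : F) • x) * a) := funext fun s => by
    rw [← reTrace_inverse_mul_map hA hB hdet, map_add, hone, map_smul]
  rw [h] at h2
  exact neg_injective (h2.unique h1)

theorem injective_of_preservesNormDet (hA : IsLocallyMatrix F A) (hB : IsLocallyMatrix F B)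
    (hdet : PreservesNormDet F ψ) (hone : ψ 1 = 1) : Function.Injective ψ := by
  rw [injective_iff_map_eq_zero]
  intro a ha
  refine eq_zero_of_reTrace_mul_eq_zero hA a fun x => ?_
  rw [← reTrace_map_mul_map hA hB hdet hone, ha, zero_mul]
  simp [reTrace]

/-- Paired with any ψ(a), both sides give Re tr(b⁻¹a); surjectivity makes ψ(a) arbitrary, and
nondegeneracy concludes. -/
theorem map_ringInverse_of_preservesNormDet (hA : IsLocallyMatrix F A)
    (hB : IsLocallyMatrix F B) (hdet : PreservesNormDet F ψ) (hone : ψ 1 = 1)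
    (hsurj : Function.Surjective ψ) (b : A) : ψ (Ring.inverse b) = Ring.inverse (ψ b) := by
  refine eq_of_reTrace_mul_eq hB fun y => ?_
  obtain ⟨a, rfl⟩ := hsurj y
  rw [reTrace_map_mul_map hA hB hdet hone, reTrace_inverse_mul_map hA hB hdet]

/-- Hua's identity for `x * x - x`. -/
theorem inverse_sub_one_sub_inverse {R : Type*} [Ring R] {x : R} (hx : IsUnit x)
    (hx1 : IsUnit (x - 1)) :
    Ring.inverse (x - 1) - Ring.inverse x = Ring.inverse (x * x - x) := by
  have hf : x * x - x = x * (x - 1) := by rw [mul_sub, mul_one]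
  have hu : IsUnit (x * x - x) := hf ▸ hx.mul hx1
  suffices h : (Ring.inverse (x - 1) - Ring.inverse x) * (x * x - x) = 1 by
    simpa only [Ring.mul_inverse_cancel_right _ _ hu, one_mul]
      using congrArg (· * Ring.inverse (x * x - x)) h
  rw [sub_mul]
  nth_rewrite 1 [show x * x - x = (x - 1) * x by rw [sub_mul, one_mul]]
  rw [hf, Ring.inverse_mul_cancel_left _ _ hx1, Ring.inverse_mul_cancel_left _ _ hx,
    sub_sub_cancel]

theorem map_mul_self_of_preservesNormDet (hA : IsLocallyMatrix F A)
    (hB : IsLocallyMatrix F B) (hdet : PreservesNormDet F ψ) (hone : ψ 1 = 1)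
    (hsurj : Function.Surjective ψ) (x : A) : ψ (x * x) = ψ x * ψ x := by
  have unit := isUnit_map_iff_of_preservesNormDet hA hB hdet
  have key : ∀ y, IsUnit y → IsUnit (y - 1) → ψ (y * y) = ψ y * ψ y := by
    intro y hy hy1
    have hm := map_ringInverse_of_preservesNormDet hA hB hdet hone hsurj
    have e : ψ (y - 1) = ψ y - 1 := by rw [map_sub, hone]
    have h := congrArg ψ (inverse_sub_one_sub_inverse hy hy1)
    rw [map_sub, hm, hm, hm, e,
      inverse_sub_one_sub_inverse ((unit y).2 hy) (e ▸ (unit _).2 hy1)] at h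
    have hu : IsUnit (y * y - y) := by
      rw [show y * y - y = y * (y - 1) by rw [mul_sub, mul_one]]; exact hy.mul hy1
    have hu' : IsUnit (ψ y * ψ y - ψ y) := by
      rw [show ψ y * ψ y - ψ y = ψ y * (ψ y - 1) by rw [mul_sub, mul_one]]
      exact ((unit y).2 hy).mul (e ▸ (unit _).2 hy1)
    have h' : ψ y * ψ y - ψ y = ψ (y * y - y) := by
      rw [← mul_one (ψ y * ψ y - ψ y), ← Ring.inverse_mul_cancel _ ((unit _).2 hu), ← h,
        Ring.mul_inverse_cancel_left _ _ hu']
    rw [map_sub] at h'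
    exact (sub_left_injective h').symm
  -- Choose a scalar c with x + c and x + c - 1 both invertible. As ψ is linear and unital, the
  -- identity for squares at x + c is equivalent to that at x.
  have fin := (finite_setOf_not_isUnit_add_smul_one hA x).union
    (finite_setOf_not_isUnit_add_smul_one hA (x - 1))
  obtain ⟨c, hc⟩ := fin.infinite_compl.nonempty
  simp only [Set.mem_compl_iff, Set.mem_union, Set.mem_ofPred_eq, not_or, not_not] at hc
  have h := key (x + c • (1 : A)) hc.1 (by rw [add_sub_right_comm]; exact hc.2)
  simp only [add_mul, mul_add, map_add, map_smul, hone, smul_mul_assoc, mul_smul_comm, one_mul,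
    mul_one] at h
  rw [← sub_eq_zero] at h ⊢
  rw [← h]
  abel

end Preserver

end LocMat

/-! ### Reduction to the unital case and conclusion -/

theorem theorem2 {F A B : Type*} [RCLike F] [Ring A] [Algebra F A] [Ring B] [Algebra F B]
    (hA : LocMat.IsLocallyMatrix F A) (hB : LocMat.IsLocallyMatrix F B)
    (φ : A →ₗ[F] B) (hsurj : Function.Surjective φ) (hdet : LocMat.PreservesNormDet F φ) :
    (∃ (φ₁ : A ≃ₐ[F] B) (X Y : Bˣ), LocMat.normDet F ((X : B) * (Y : B)) = 1 ∧
      ∀ a : A, φ a = (X : B) * φ₁ a * (Y : B)) ∨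
    (∃ (φ₂ : A ≃ₐ[F] Bᵐᵒᵖ) (X Y : Bˣ), LocMat.normDet F ((X : B) * (Y : B)) = 1 ∧
      ∀ a : A, φ a = (X : B) * (φ₂ a).unop * (Y : B)) := by
  obtain ⟨X, hX⟩ := (LocMat.isUnit_map_iff_of_preservesNormDet hA hB hdet 1).2 isUnit_one
  have hX1 : LocMat.normDet F (X : B) = 1 := by rw [hX, hdet, LocMat.normDet_one hA]
  let ψ : A →ₗ[F] B := (LinearMap.mulLeft F ((X⁻¹ : Bˣ) : B)).comp φ
  have hφ : ∀ a, φ a = X * ψ a := fun a => (Units.mul_inv_cancel_left X (φ a)).symm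
  have hψ1 : ψ 1 = 1 := by
    change ((X⁻¹ : Bˣ) : B) * φ 1 = 1
    rw [← hX, Units.inv_mul]
  have hψdet : LocMat.PreservesNormDet F ψ := fun a => by
    rw [← hdet a, hφ, LocMat.normDet_mul hB, hX1, one_mul]
  have hψsurj : Function.Surjective ψ := fun b => by
    obtain ⟨a, ha⟩ := hsurj (X * b)
    exact ⟨a, X.isUnit.mul_left_cancel (by rw [← hφ, ha])⟩
  have hψinj := LocMat.injective_of_preservesNormDet hA hB hψdet hψ1
  have two : ∀ b : B, b + b = 0 → b = 0 := fun b hb => by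
    rw [← two_smul F b] at hb
    exact (smul_eq_zero.1 hb).resolve_left two_ne_zero
  have hXX : LocMat.normDet F ((X : B) * ((1 : Bˣ) : B)) = 1 := by
    rw [Units.val_one, mul_one, hX1]
  rcases LocMat.mul_or_antimul_of_jordan hB.eq_zero_or_eq_zero two ψ.toAddMonoidHom hψsurj
    (LocMat.map_mul_self_of_preservesNormDet hA hB hψdet hψ1 hψsurj) with h | h
  · refine Or.inl ⟨AlgEquiv.ofBijective (AlgHom.ofLinearMap ψ hψ1 h) ⟨hψinj, hψsurj⟩, X, 1, hXX,
      fun a => ?_⟩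
    rw [Units.val_one, mul_one]
    exact hφ a
  · refine Or.inr ⟨AlgEquiv.ofBijective (AlgHom.ofLinearMap
      ((MulOpposite.opLinearEquiv F).toLinearMap.comp ψ) (congrArg MulOpposite.op hψ1)
      fun a b => congrArg MulOpposite.op (h a b))
      ⟨MulOpposite.op_injective.comp hψinj, MulOpposite.op_surjective.comp hψsurj⟩, X, 1, hXX,
      fun a => ?_⟩
    rw [Units.val_one, mul_one]
    exact hφ a
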